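/- Let $n\ge 3$. For a function $f$ of three elements and elements $x_1,\dots,x_n$ put $$\mathbb E_{wo,3}[f(x)]=\frac{1}{n(n-1)(n-2)}\sum_{\substack{1\le j_1,j_2,j_3\le n\\ \text{pairwise distinct}}} f(x_{j_1},x_{j_2},x_{j_3}),\qquad \mathbb E_{wr,3}[f(x)]=\frac1{n^3}\sum_{j_1,j_2,j_3=1}^n f(x_{j_1},x_{j_2},x_{j_3}).$$ (1) Let $(M,\tau)$ be a tracial von Neumann algebra (a von Neumann algebra $M$ of bounded operators on a complex Hilbert space with a faithful normal tracial state $\tau$). Let $u_1,\dots,u_n\in M$ be unitaries and $a=a^*\in M$ such that $u_1,\dots,u_n,a$ are freely independent, meaning that the unital $*$-subalgebras generated by the individual elements $u_1$, …, $u_n$, $a$ are free with respect to $\tau$. Assume $\tau(u_j)=0$ for all $j$, $\tau(a)=0$, $\tau(a^2)=1$ and $a^2\neq 1$, and set $a_j=au_j$. Then the operator inequality $\mathbb E_{wo,3}[f(a_1,\dots,a_n)]\le \mathbb E_{wr,3}[f(a_1,\dots,a_n)]$ with $f(x,y,z)=x\,y\,z\,z^*y^*x^*$ fails, that is, $$\frac{1}{n(n-1)(n-2)}\sum_{\substack{j_1,j_2,j_3\\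 \text{pairwise distinct}}} a_{j_1}a_{j_2}a_{j_3}a_{j_3}^*a_{j_2}^*a_{j_1}^*\ \not\le\ \frac1{n^3}\sum_{j_1,j_2,j_3=1}^n a_{j_1}a_{j_2}a_{j_3}a_{j_3}^*a_{j_2}^*a_{j_1}^*.$$ (2) The order form of the symmetrized arithmetic-geometric mean conjecture with constant $C_4=1$ is false for $d=3$ and every $n\ge3$: it is not true that $$\frac{1}{n(n-1)(n-2)}\sum_{\substack{j_1,j_2,j_3\\ \text{pairwise distinct}}} x_{j_1}^*x_{j_2}^*x_{j_3}^*x_{j_3}x_{j_2}x_{j_1}\ \le\ \frac1{n^3}\sum_{j_1,j_2,j_3=1}^n x_{j_1}^*x_{j_2}^*x_{j_3}^*x_{j_3}x_{j_2}x_{j_1}$$ for all bounded operators $x_1,\dots,x_n$ on all complex Hilbert spaces. -/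

import Mathlib

universe u v

open scoped ComplexOrder

/-- The without-replacement expectation of `f` over the `n` elements `x 0, …, x (n - 1)`:
the average of `f (x (j 0), …, x (j (k - 1)))` over all `k`-tuples `j` of pairwise distinct
indices (injective maps `Fin k ↪ Fin n`). It is meaningful for `k ≤ n`. -/
noncomputable def expWithoutReplacement {D E : Type*} [AddCommMonoid E] [Module ℂ E] {n k : ℕ}
    (f : (Fin k → D) → E) (x : Fin n → D) : E :=
  (((n - k).factorial : ℂ) / (n.factorial : ℂ)) • ∑ j : Fin k ↪ Fin n, f (fun i => x (j i))

/-- The with-replacement expectation of `f` over the `n` elements `x 0, …, x (n - 1)`: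
the average of `f (x (j 0), …, x (j (k - 1)))` over all `k`-tuples `j` of indices. -/
noncomputable def expWithReplacement {D E : Type*} [AddCommMonoid E] [Module ℂ E] {n k : ℕ}
    (f : (Fin k → D) → E) (x : Fin n → D) : E :=
  ((n : ℂ) ^ k)⁻¹ • ∑ j : Fin k → Fin n, f (fun i => x (j i))

/-- The symmetrized product `v₁^* v₂^* ⋯ v_k^* v_k ⋯ v₂ v₁`. -/
def symmetrizedProduct {R : Type*} [Ring R] [StarRing R] {k : ℕ} (v : Fin k → R) : R :=
  (List.ofFn fun i => star (v i)).prod * star (List.ofFn fun i => star (v i)).prod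

/-- The order form of the symmetrized arithmetic-geometric mean conjecture for `n` operators,
degree `k` and constant `C`: for all bounded operators `x₁, …, x_n` on every complex Hilbert
space, `𝔼_{wo,k}(x) ≤ C · 𝔼_{wr,k}(x)` in the order of bounded self-adjoint operators. -/
def OrderSymmetricAGM (n k : ℕ) (C : ℝ) : Prop :=
  ∀ (H : Type u) [NormedAddCommGroup H] [InnerProductSpace ℂ H] [CompleteSpace H]
    (x : Fin n → (H →L[ℂ] H)),
    expWithoutReplacement (k := k) symmetrizedProduct x ≤
      (C : ℂ) • expWithReplacement (k := k) symmetrizedProduct x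

/-- `τ` is a faithful normal tracial state on the von Neumann algebra `M`; the pair `(M, τ)` is
then a tracial von Neumann algebra. Normality is stated as preservation of suprema of (bounded)
upward directed sets of positive elements. -/
structure IsFaithfulNormalTracialState {H : Type*} [NormedAddCommGroup H]
    [InnerProductSpace ℂ H] [CompleteSpace H] (M : VonNeumannAlgebra H) (τ : M.toStarSubalgebra →ₗ[ℂ] ℂ) :
    Prop where
  map_one : τ 1 = 1
  nonneg : ∀ x : M.toStarSubalgebra, 0 ≤ τ (star x * x)
  tracial : ∀ x y : M.toStarSubalgebra, τ (x * y) = τ (y * x)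
  faithful : ∀ x : M.toStarSubalgebra, τ (star x * x) = 0 → x = 0
  normal : ∀ (s : Set M.toStarSubalgebra) (x : M.toStarSubalgebra), s.Nonempty → DirectedOn (· ≤ ·) s → (∀ y ∈ s, 0 ≤ y) →
    IsLUB s x → IsLUB (τ '' s) (τ x)

/-- Free independence, with respect to `φ`, of a family of elements `x i` of a unital complex
`*`-algebra: the unital `*`-subalgebras generated by the individual `x i` are free, i.e. `φ`
vanishes on every non-empty product `b₁ b₂ ⋯ b_m` of elements with `φ (b_l) = 0`, where `b_l` lies
in the `*`-subalgebra generated by `x (i_l)` and neighbouring indices `i_l`, `i_{l+1}` differ. -/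
def FreelyIndependent {ι A : Type*} [Ring A] [StarRing A] [Algebra ℂ A] [StarModule ℂ A]
    (φ : A →ₗ[ℂ] ℂ) (x : ι → A) : Prop :=
  ∀ w : List (ι × A), w ≠ [] → w.IsChain (fun p q => p.1 ≠ q.1) →
    (∀ p ∈ w, p.2 ∈ StarAlgebra.adjoin ℂ {x p.1} ∧ φ p.2 = 0) →
    φ (w.map Prod.snd).prod = 0

/-! Part (1). Put `b = a * a - 1`, which is centred. Since `u k` is unitary, the product for `(i, j,
k)` does not depend on `k`, and repeated use of `a * a = 1 + b` together with freeness gives it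
trace 1 (`map_product`). Both averages therefore have trace 1, so by faithfulness the inequality
would force equality (`eq_of_le_of_apply_eq`). Equality is refuted by pairing with `a * w * a`,
where `w` is `innerWord` at `(0, 0)`. The pairing with the product for `(i, j, k)` is a function of
`i` alone plus `φ (b * b)` when `i = j = 0` (`map_outer_mul_product`). One-coordinate functions
average equally in both schemes, while `i = j = 0` occurs only with replacement. Hence `φ (b * b) =
0`, so `b = 0` by faithfulness, against `a ^ 2 ≠ 1`. Part (2). For the rank-one steps of a finite
shift, only the tuple `(0, 1, 2)` moves the first basis vector three times without killing it. It
has distinct entries, so its weight is larger without replacement. -/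

/-! ### Moments of alternating words in free unitaries and `a` -/

section Free

variable {ι A : Type*} [Ring A] [StarRing A] [Algebra ℂ A] [StarModule ℂ A]

/-- The data used in the moment computations: a tracial functional `φ`, unitaries `u i` and an
element `a` with `a * a = 1 + b`, all of them centred and `a`, `(u i)` free. -/
structure FreeUnitaryData (φ : A →ₗ[ℂ] ℂ) (u : ι → A) (a b : A) : Prop where
  free : FreelyIndependent φ (fun i : Option ι => i.elim a u)
  tracial : ∀ x y : A, φ (x * y) = φ (y * x)
  apply_one : φ 1 = 1
  star_mul_self : ∀ i, star (u i) * u i = 1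
  mul_star_self : ∀ i, u i * star (u i) = 1
  map_unitary : ∀ i, φ (u i) = 0
  map_star_unitary : ∀ i, φ (star (u i)) = 0
  map_a : φ a = 0
  map_b : φ b = 0
  star_a : star a = a
  a_mul_a : a * a = 1 + b

namespace FreeUnitaryData

variable {φ : A →ₗ[ℂ] ℂ} {u : ι → A} {a b : A} (h : FreeUnitaryData φ u a b)
include h

theorem b_eq : b = a * a - 1 := by rw [h.a_mul_a]; abel

theorem b_mem_adjoin : b ∈ StarAlgebra.adjoin ℂ {a} := by
  have ha := StarAlgebra.self_mem_adjoin_singleton ℂ a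
  rw [h.b_eq]
  exact sub_mem (mul_mem ha ha) (one_mem _)

/-- The centred letters from which the alternating words are built. -/
def Letter (φ : A →ₗ[ℂ] ℂ) (u : ι → A) (a : A) (p : Option ι × A) : Prop :=
  p.2 ∈ StarAlgebra.adjoin ℂ {p.1.elim a u} ∧ φ p.2 = 0

theorem letter_a : Letter φ u a (none, a) := ⟨StarAlgebra.self_mem_adjoin_singleton ℂ a, h.map_a⟩

theorem letter_b : Letter φ u a (none, b) := ⟨h.b_mem_adjoin, h.map_b⟩

/-- Two adjacent letters `b` merge into `b * b`, which must be centred again before freeness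
applies. -/
theorem letter_sq_b : Letter φ u a (none, b * b - algebraMap ℂ A (φ (b * b))) :=
  ⟨sub_mem (mul_mem h.b_mem_adjoin h.b_mem_adjoin) (algebraMap_mem _ _), by
    simp [Algebra.algebraMap_eq_smul_one, h.apply_one]⟩

theorem letter_unitary (i : ι) : Letter φ u a (some i, u i) :=
  ⟨StarAlgebra.self_mem_adjoin_singleton ℂ (u i), h.map_unitary i⟩

theorem letter_star_unitary (i : ι) : Letter φ u a (some i, star (u i)) :=
  ⟨star_mem (StarAlgebra.self_mem_adjoin_singleton ℂ (u i)), h.map_star_unitary i⟩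

theorem map_word (w : List (Option ι × A)) (hne : w ≠ [])
    (hc : w.IsChain (fun p q => p.1 ≠ q.1)) (hw : ∀ p ∈ w, Letter φ u a p) :
    φ (w.map Prod.snd).prod = 0 := h.free w hne hc hw

/-- The word `u_i a u_j b u_j^* a u_i^*`. -/
def innerWord (u : ι → A) (a b : A) (i j : ι) : A :=
  u i * a * u j * b * star (u j) * a * star (u i)

theorem map_mul_self_a : φ (a * a) = 1 := by simp [h.a_mul_a, h.apply_one, h.map_b]

theorem product_eq (i j k : ι) :
    a * u i * (a * u j) * (a * u k) * star (a * u k) * star (a * u j) * star (a * u i) =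
      a * u i * (a * u j) * (a * a) * (star (u j) * a) * (star (u i) * a) := by
  simp only [star_mul, h.star_a]
  calc _ = a * u i * (a * u j) * (a * (u k * star (u k)) * a) * (star (u j) * a)
        * (star (u i) * a) := by noncomm_ring
    _ = _ := by rw [h.mul_star_self, mul_one]

/-- Replacing the inner `a * a` by `1 + b`, cancelling `u j`, and repeating with `u i` leaves `a *
a` plus two alternating words of centred letters, which have moment zero. -/
theorem map_product (i j : ι) :
    φ (a * u i * (a * u j) * (a * a) * (star (u j) * a) * (star (u i) * a)) = 1 := by
  have e : a * u i * (a * u j) * (a * a) * (star (u j) * a) * (star (u i) * a) =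
      a * a + a * u i * b * star (u i) * a + a * innerWord u a b i j * a := by
    calc _ = a * u i * a * (u j * star (u j)) * a * star (u i) * a
          + a * innerWord u a b i j * a := by
          rw [h.a_mul_a, innerWord]; noncomm_ring
      _ = a * (u i * star (u i)) * a + a * u i * b * star (u i) * a
          + a * innerWord u a b i j * a := by
          have : a * u i * a * (u j * star (u j)) * a * star (u i) * a
            = a * u i * (a * a) * star (u i) * a := by
              rw [h.mul_star_self]; noncomm_ring
          rw [this, h.a_mul_a]; noncomm_ring
      _ = _ := by rw [h.mul_star_self, mul_one]
  have h1 := h.map_word [(none, a), (some i, u i), (none, b), (some i, star (u i)), (none, a)]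
    (by simp) (by simp)
    (by simp [h.letter_a, h.letter_b, h.letter_unitary, h.letter_star_unitary])
  have h2 := h.map_word [(none, a), (some i, u i), (none, a), (some j, u j), (none, b),
      (some j, star (u j)), (none, a), (some i, star (u i)), (none, a)]
    (by simp) (by simp)
    (by simp [h.letter_a, h.letter_b, h.letter_unitary, h.letter_star_unitary])
  simp only [List.map_cons, List.map_nil, List.prod_cons, List.prod_nil, mul_one] at h1 h2
  rw [e, map_add, map_add, h.map_mul_self_a]
  simp only [innerWord, mul_assoc]
  rw [h1, h2]; simp

/-- An alternating word that begins with a letter of some `u k` has moment zero, and so has the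
word obtained by putting `b` in front. -/
theorem map_word_and_b_mul_word (k : ι) (x : A) (w : List (Option ι × A))
    (hc : ((some k, x) :: w).IsChain (fun p q => p.1 ≠ q.1))
    (hw : ∀ p ∈ (some k, x) :: w, Letter φ u a p) :
    φ (x * (w.map Prod.snd).prod) = 0 ∧ φ (b * (x * (w.map Prod.snd).prod)) = 0 := by
  have h1 := h.map_word _ (by simp) hc hw
  have h2 := h.map_word ((none, b) :: (some k, x) :: w) (by simp)
    (List.isChain_cons_cons.2 ⟨by simp, hc⟩) (List.forall_mem_cons.2 ⟨h.letter_b, hw⟩)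
  simp only [List.map_cons, List.prod_cons] at h1 h2
  exact ⟨h1, h2⟩

/-- Mixed moments of two inner words, possibly preceded by the letter `b`. -/
theorem map_innerWord_mul_innerWord_and [DecidableEq ι] (k i j : ι) :
    φ (innerWord u a b k k * innerWord u a b i j) =
        (if k = i ∧ k = j then φ (b * b) else 0) ∧
      φ (b * (innerWord u a b k k * innerWord u a b i j)) = 0 := by
  -- The two inner words meet at `star (u k) * u i`. For `k ≠ i` their concatenation is already
  -- alternating.
  by_cases hi : k = i
  swap
  · have h1 := h.map_word_and_b_mul_word k (u k) [(none, a), (some k, u k), (none, b),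
      (some k, star (u k)), (none, a), (some k, star (u k)),
      (some i, u i), (none, a), (some j, u j), (none, b),
      (some j, star (u j)), (none, a), (some i, star (u i))] (by simp [hi])
      (by simp [h.letter_a, h.letter_b, h.letter_unitary, h.letter_star_unitary])
    simp only [List.map_cons, List.map_nil, List.prod_cons, List.prod_nil, mul_one] at h1
    simpa [innerWord, mul_assoc, hi] using h1
  subst hi
  have h1 := h.map_word_and_b_mul_word k (u k) [(none, a), (some k, u k), (none, b),
      (some k, star (u k)), (none, b), (some j, u j), (none, b),
      (some j, star (u j)), (none, a), (some k, star (u k))] (by simp)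
      (by simp [h.letter_a, h.letter_b, h.letter_unitary, h.letter_star_unitary])
  simp only [List.map_cons, List.map_nil, List.prod_cons, List.prod_nil, mul_one] at h1
  -- For `k = i` the unitaries cancel and `a * a = 1 + b` appears in the middle. The `b` term is
  -- alternating; the `1` term brings `star (u k)` next to `u j`.
  have e : innerWord u a b k k * innerWord u a b k j =
      u k * a * u k * b * (star (u k) * u j) * b * star (u j) * a * star (u k) +
      u k * (a * (u k * (b * (star (u k) * (b * (u j * (b * (star (u j) *
        (a * star (u k)))))))))) := by
    calc _ = u k * a * u k * b * star (u k) * a * (star (u k) * u k) * a * u j * b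
          * star (u j) * a * star (u k) := by rw [innerWord, innerWord]; noncomm_ring
      _ = u k * a * u k * b * star (u k) * (a * a) * u j * b
          * star (u j) * a * star (u k) := by rw [h.star_mul_self]; noncomm_ring
      _ = _ := by rw [h.a_mul_a]; noncomm_ring
  by_cases hj : k = j
  swap
  · have h2 := h.map_word_and_b_mul_word k (u k) [(none, a), (some k, u k), (none, b),
      (some k, star (u k)), (some j, u j), (none, b),
      (some j, star (u j)), (none, a), (some k, star (u k))] (by simp [hj])
      (by simp [h.letter_a, h.letter_b, h.letter_unitary, h.letter_star_unitary])
    simp only [List.map_cons, List.map_nil, List.prod_cons, List.prod_nil, mul_one] at h2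
    rw [e, mul_add, map_add, map_add, h1.1, h1.2]
    simpa [mul_assoc, hj] using h2
  subst hj
  -- For `k = i = j` the middle is `b * b`, the sum of its centred part and the scalar `β`. The
  -- scalar lets the outer letters collapse to `1 + u k * b * star (u k)`; the `1` contributes `β`,
  -- or `β • φ b = 0` when `b` stands in front.
  have h2 := h.map_word_and_b_mul_word k (u k) [(none, a), (some k, u k),
      (none, b * b - algebraMap ℂ A (φ (b * b))),
      (some k, star (u k)), (none, a), (some k, star (u k))] (by simp)
      (by simp [h.letter_a, h.letter_sq_b, h.letter_unitary, h.letter_star_unitary])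
  have h3 := h.map_word_and_b_mul_word k (u k) [(none, b), (some k, star (u k))] (by simp)
      (by simp [h.letter_b, h.letter_unitary, h.letter_star_unitary])
  simp only [List.map_cons, List.map_nil, List.prod_cons, List.prod_nil, mul_one] at h2 h3
  set β := φ (b * b)
  have e2 : u k * a * u k * b * (star (u k) * u k) * b * star (u k) * a * star (u k) =
      u k * (a * (u k * ((b * b - algebraMap ℂ A β) * (star (u k) * (a * star (u k)))))) +
      β • (1 + u k * (b * star (u k))) := by
    have e3 : u k * (a * (u k * (algebraMap ℂ A β * (star (u k) * (a * star (u k)))))) =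
        β • (1 + u k * (b * star (u k))) := by
      rw [Algebra.algebraMap_eq_smul_one]
      simp only [smul_mul_assoc, one_mul, mul_smul_comm]
      congr 1
      calc _ = u k * a * (u k * star (u k)) * a * star (u k) := by noncomm_ring
        _ = u k * (a * a) * star (u k) := by rw [h.mul_star_self]; noncomm_ring
        _ = u k * star (u k) + u k * (b * star (u k)) := by rw [h.a_mul_a]; noncomm_ring
        _ = _ := by rw [h.mul_star_self]
    rw [← e3, h.star_mul_self]
    noncomm_ring
  rw [e, e2]
  simp only [mul_add, map_add, smul_add, mul_smul_comm, map_smul, mul_one]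
  rw [h1.1, h1.2, h2.1, h2.2, h3.1, h3.2, h.apply_one, h.map_b]
  simp

theorem map_outer [DecidableEq ι] (k i j : ι) :
    φ (a * innerWord u a b k k * a * (a * innerWord u a b i j * a)) =
      if k = i ∧ k = j then φ (b * b) else 0 := by
  set w := innerWord u a b k k with hw
  set v := innerWord u a b i j with hv
  -- By traciality the last `a` moves to the front, giving two factors `a * a = 1 + b`. A `b`
  -- between `w` and `v` prevents any cancellation, even for `k = i`, so only `w * v` can
  -- contribute.
  have e : a * (a * w * a * (a * v)) =
      w * v + b * (w * v) + w * b * v + b * w * b * v := by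
    calc _ = (a * a) * w * (a * a) * v := by noncomm_ring
      _ = _ := by rw [h.a_mul_a]; noncomm_ring
  have h1 := h.map_word [(some k, u k), (none, a), (some k, u k), (none, b),
      (some k, star (u k)), (none, a), (some k, star (u k)), (none, b),
      (some i, u i), (none, a), (some j, u j), (none, b),
      (some j, star (u j)), (none, a), (some i, star (u i))]
    (by simp) (by simp)
    (by simp [h.letter_a, h.letter_b, h.letter_unitary, h.letter_star_unitary])
  have h2 := h.map_word [(none, b), (some k, u k), (none, a), (some k, u k), (none, b),
      (some k, star (u k)), (none, a), (some k, star (u k)), (none, b),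
      (some i, u i), (none, a), (some j, u j), (none, b),
      (some j, star (u j)), (none, a), (some i, star (u i))]
    (by simp) (by simp)
    (by simp [h.letter_a, h.letter_b, h.letter_unitary, h.letter_star_unitary])
  simp only [List.map_cons, List.map_nil, List.prod_cons, List.prod_nil, mul_one] at h1 h2
  rw [← mul_assoc, h.tracial, e, map_add, map_add, map_add,
    (h.map_innerWord_mul_innerWord_and k i j).1, (h.map_innerWord_mul_innerWord_and k i j).2]
  simp only [hw, hv, innerWord, mul_assoc]
  rw [h1, h2]; simp

theorem map_outer_mul_product [DecidableEq ι] (k i j : ι) :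
    φ (a * innerWord u a b k k * a *
        (a * u i * (a * u j) * (a * a) * (star (u j) * a) * (star (u i) * a))) =
      φ (a * innerWord u a b k k * a * (a * u i * (a * a) * star (u i) * a)) +
        if k = i ∧ k = j then φ (b * b) else 0 := by
  rw [← h.map_outer k i j, ← map_add, ← mul_add]
  congr 2
  calc _ = a * u i * a * (u j * star (u j)) * a * star (u i) * a
        + a * innerWord u a b i j * a := by
        rw [h.a_mul_a, innerWord]; noncomm_ring
    _ = _ := by rw [h.mul_star_self]; noncomm_ring

end FreeUnitaryData
end Free

/-! ### Averages of functions of one coordinate -/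

section Averages

theorem map_expWithoutReplacement {D E F : Type*} [AddCommMonoid E] [Module ℂ E]
    [AddCommMonoid F] [Module ℂ F] {n k : ℕ} (T : E →ₗ[ℂ] F) (f : (Fin k → D) → E)
    (x : Fin n → D) :
    T (expWithoutReplacement f x) = expWithoutReplacement (fun v => T (f v)) x := by
  simp [expWithoutReplacement]

theorem map_expWithReplacement {D E F : Type*} [AddCommMonoid E] [Module ℂ E]
    [AddCommMonoid F] [Module ℂ F] {n k : ℕ} (T : E →ₗ[ℂ] F) (f : (Fin k → D) → E)
    (x : Fin n → D) :
    T (expWithReplacement f x) = expWithReplacement (fun v => T (f v)) x := by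
  simp [expWithReplacement]

theorem factorial_ratio_mul_card {n k : ℕ} (hk : k ≤ n) :
    (((n - k).factorial : ℂ) / (n.factorial : ℂ)) * (Fintype.card (Fin k ↪ Fin n) : ℂ) = 1 := by
  rw [Fintype.card_embedding_eq, Fintype.card_fin, Fintype.card_fin, div_mul_eq_mul_div,
    ← Nat.cast_mul, Nat.factorial_mul_descFactorial hk]
  exact div_self (Nat.cast_ne_zero.2 n.factorial_ne_zero)

/-- The average over injective tuples of a function of one coordinate is its mean. -/
theorem sum_embedding_apply {n k : ℕ} [NeZero n] (i : Fin k) (p : Fin n → ℂ) :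
    (n : ℂ) * ∑ j : Fin k ↪ Fin n, p (j i) =
      (Fintype.card (Fin k ↪ Fin n) : ℂ) * ∑ m, p m := by
  -- Cyclic translation of the values permutes the injective tuples; summing over all translations
  -- makes `j i + c` run through every index once.
  have hs : ∀ c : Fin n, ∑ j : Fin k ↪ Fin n, p (j i + c) = ∑ j : Fin k ↪ Fin n, p (j i) := fun c =>
    Fintype.sum_equiv (Equiv.embeddingCongr (Equiv.refl _) (Equiv.addRight c)) _ _ (by simp)
  have h1 : ∑ c : Fin n, ∑ j : Fin k ↪ Fin n, p (j i + c) =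
      (n : ℂ) * ∑ j : Fin k ↪ Fin n, p (j i) := by simp [hs]
  rw [← h1, Finset.sum_comm]
  have h2 : ∀ j : Fin k ↪ Fin n, ∑ c, p (j i + c) = ∑ m, p m := fun j =>
    Fintype.sum_equiv (Equiv.addLeft (j i)) _ _ (by simp)
  simp [h2]

theorem sum_tuple_apply {n k : ℕ} [NeZero n] (i : Fin k) (p : Fin n → ℂ) :
    (n : ℂ) * ∑ j : Fin k → Fin n, p (j i) = (n : ℂ) ^ k * ∑ m, p m := by
  have hs : ∀ c : Fin n, ∑ j : Fin k → Fin n, p (j i + c) = ∑ j : Fin k → Fin n, p (j i) := fun c =>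
    Fintype.sum_equiv (Equiv.arrowCongr (Equiv.refl _) (Equiv.addRight c)) _ _ (by simp)
  have h1 : ∑ c : Fin n, ∑ j : Fin k → Fin n, p (j i + c) =
      (n : ℂ) * ∑ j : Fin k → Fin n, p (j i) := by simp [hs]
  rw [← h1, Finset.sum_comm]
  have h2 : ∀ j : Fin k → Fin n, ∑ c, p (j i + c) = ∑ m, p m := fun j =>
    Fintype.sum_equiv (Equiv.addLeft (j i)) _ _ (by simp)
  simp [h2]

theorem expWithoutReplacement_apply {n k : ℕ} (hn : n ≠ 0) (hk : k ≤ n) (i : Fin k)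
    (p : Fin n → ℂ) :
    expWithoutReplacement (fun v : Fin k → Fin n => p (v i)) id = (n : ℂ)⁻¹ * ∑ m, p m := by
  have : NeZero n := ⟨hn⟩
  have hn' : (n : ℂ) ≠ 0 := Nat.cast_ne_zero.2 hn
  rw [eq_inv_mul_iff_mul_eq₀ hn', expWithoutReplacement, smul_eq_mul, mul_left_comm]
  simp only [id_eq]
  rw [sum_embedding_apply, ← mul_assoc, factorial_ratio_mul_card hk, one_mul]

theorem expWithReplacement_apply {n k : ℕ} (hn : n ≠ 0) (i : Fin k) (p : Fin n → ℂ) :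
    expWithReplacement (fun v : Fin k → Fin n => p (v i)) id = (n : ℂ)⁻¹ * ∑ m, p m := by
  have : NeZero n := ⟨hn⟩
  have hn' : (n : ℂ) ≠ 0 := Nat.cast_ne_zero.2 hn
  rw [eq_inv_mul_iff_mul_eq₀ hn', expWithReplacement, smul_eq_mul, mul_left_comm]
  simp only [id_eq]
  rw [sum_tuple_apply, ← mul_assoc, inv_mul_cancel₀ (pow_ne_zero _ hn'), one_mul]

end Averages

/-! ### Positivity and faithfulness of the trace -/

section Positive

variable {H : Type*} [NormedAddCommGroup H] [InnerProductSpace ℂ H] [CompleteSpace H]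

/-- By the double commutant theorem it suffices that the square root commutes with whatever commutes
with `x`, a property of the functional calculus. -/
theorem VonNeumannAlgebra.sqrt_mem (M : VonNeumannAlgebra H) {x : H →L[ℂ] H} (hx : x ∈ M) :
    CFC.sqrt x ∈ M := by
  rw [← M.commutant_commutant, VonNeumannAlgebra.mem_commutant_iff]
  intro g hg
  have hc : Commute x g := VonNeumannAlgebra.mem_commutant_iff.1 hg x hx
  exact (hc.cfcₙ_nnreal _).symm

/-- A positive element of a von Neumann algebra is `s^* s` with `s` in the algebra. -/
theorem VonNeumannAlgebra.exists_star_mul_self (M : VonNeumannAlgebra H) (x : M.toStarSubalgebra)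
    (hx : 0 ≤ (x : H →L[ℂ] H)) : ∃ s : M.toStarSubalgebra, star s * s = x := by
  refine ⟨⟨CFC.sqrt (x : H →L[ℂ] H), M.sqrt_mem x.2⟩, Subtype.ext ?_⟩
  have hs : IsSelfAdjoint (CFC.sqrt (x : H →L[ℂ] H)) := (CFC.sqrt_nonneg _).isSelfAdjoint
  have := CFC.sqrt_mul_sqrt_self (x : H →L[ℂ] H) hx
  simpa [hs.star_eq] using this

variable {M : VonNeumannAlgebra H} {τ : M.toStarSubalgebra →ₗ[ℂ] ℂ}

theorem IsFaithfulNormalTracialState.eq_of_le_of_apply_eq (hτ : IsFaithfulNormalTracialState M τ)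
    {x y : M.toStarSubalgebra} (hle : x ≤ y) (he : τ x = τ y) : x = y := by
  obtain ⟨s, hs⟩ := M.exists_star_mul_self (y - x) (sub_nonneg.2 (show (x : H →L[ℂ] H) ≤ y from hle))
  have : s = 0 := hτ.faithful s (by rw [hs, map_sub, he, sub_self])
  rw [this, mul_zero] at hs
  exact (sub_eq_zero.1 hs.symm).symm

/-- Polarization: positivity makes `τ` real on `star y * y` for `y = x`, `1 + x` and `1 + I • x`,
and the last two control the imaginary and the real part of `τ (star x)`. -/
theorem IsFaithfulNormalTracialState.apply_star_eq_zero (hτ : IsFaithfulNormalTracialState M τ)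
    {x : M.toStarSubalgebra} (hx : τ x = 0) : τ (star x) = 0 := by
  have h0 := (Complex.nonneg_iff.1 (hτ.nonneg x)).2
  have h1 := (Complex.nonneg_iff.1 (hτ.nonneg (1 + x))).2
  have h2 := (Complex.nonneg_iff.1 (hτ.nonneg (1 + Complex.I • x))).2
  have e1 : star (1 + x) * (1 + x) = 1 + x + star x + star x * x := by
    rw [star_add, star_one]; noncomm_ring
  have e2 : star (1 + Complex.I • x) * (1 + Complex.I • x) =
      1 + Complex.I • x - Complex.I • star x + star x * x := by
    rw [star_add, star_one, star_smul, Complex.star_def, Complex.conj_I]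
    simp only [mul_add, add_mul, one_mul, mul_one, smul_mul_smul_comm, neg_mul, Complex.I_mul_I,
      neg_neg, one_smul, neg_smul]
    abel
  rw [e1] at h1
  rw [e2] at h2
  simp only [map_add, map_sub, map_smul, hτ.map_one, hx, Complex.add_im, Complex.sub_im,
    Complex.one_im, Complex.zero_im, Complex.zero_re, smul_eq_mul, Complex.mul_im, Complex.I_re,
    Complex.I_im] at h1 h2
  apply Complex.ext
  · simp only [Complex.zero_re]; linarith
  · simp only [Complex.zero_im]; linarith

end Positive

/-! ### The shift counterexample for the symmetrized order form -/

section Shift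

/-- The `m`-th step `e_m ↦ e_{m+1}` of the shift on a space with basis `e_0, …, e_n`; the other
basis vectors are mapped to `0`. -/
noncomputable def shiftStep (n : ℕ) (m : Fin n) :
    EuclideanSpace ℂ (ULift.{v} (Fin (n + 1))) →L[ℂ] EuclideanSpace ℂ (ULift.{v} (Fin (n + 1))) :=
  (EuclideanSpace.proj (ULift.up m.castSucc)).smulRight
    (EuclideanSpace.single (ULift.up m.succ) (1 : ℂ))

theorem shiftStep_single (n : ℕ) (m : Fin n) (s : Fin (n + 1)) :
    shiftStep.{v} n m (EuclideanSpace.single (ULift.up s) (1 : ℂ)) =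
      if (m : ℕ) = s then EuclideanSpace.single (ULift.up m.succ) (1 : ℂ) else 0 := by
  by_cases hm : (m : ℕ) = s
  · have : m.castSucc = s := Fin.ext hm
    simp [shiftStep, ← this]
  · have : m.castSucc ≠ s := fun h => hm (by simp [← h])
    simp [shiftStep, this, hm]

theorem shiftStep_path (n : ℕ) (i j k : Fin n) :
    shiftStep.{v} n k (shiftStep n j (shiftStep n i (EuclideanSpace.single (ULift.up 0) (1 : ℂ)))) =
      if (i : ℕ) = 0 ∧ (j : ℕ) = 1 ∧ (k : ℕ) = 2 then
        EuclideanSpace.single (ULift.up k.succ) (1 : ℂ) else 0 := by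
  rw [shiftStep_single]
  by_cases hi : (i : ℕ) = 0
  · by_cases hj : (j : ℕ) = 1
    · simp [hi, hj, shiftStep_single]
    · simp [hi, hj, shiftStep_single]
  · simp [hi]

theorem inner_symmetrizedProduct {H : Type*} [NormedAddCommGroup H] [InnerProductSpace ℂ H]
    [CompleteSpace H] (v : Fin 3 → (H →L[ℂ] H)) (ξ : H) :
    inner ℂ ξ (symmetrizedProduct v ξ) = (‖v 2 (v 1 (v 0 ξ))‖ : ℂ) ^ 2 := by
  have e : symmetrizedProduct v = star (v 2 * v 1 * v 0) * (v 2 * v 1 * v 0) := by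
    simp [symmetrizedProduct, List.ofFn_succ, mul_assoc]
  rw [e, ContinuousLinearMap.star_eq_adjoint, mul_apply_eq_comp,
    ContinuousLinearMap.adjoint_inner_right, inner_self_eq_norm_sq_to_K]
  rfl

theorem inner_symmetrizedProduct_shiftStep {n : ℕ} (hn : 3 ≤ n) (j : Fin 3 → Fin n) :
    inner ℂ (EuclideanSpace.single (ULift.up 0) (1 : ℂ))
      (symmetrizedProduct (fun i => shiftStep.{v} n (j i))
        (EuclideanSpace.single (ULift.up 0) (1 : ℂ))) =
      if j = Fin.castLE hn then (1 : ℂ) else 0 := by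
  have hiff : j = Fin.castLE hn ↔ (j 0 : ℕ) = 0 ∧ (j 1 : ℕ) = 1 ∧ (j 2 : ℕ) = 2 := by
    simp [funext_iff, Fin.forall_fin_succ, Fin.ext_iff]
  rw [inner_symmetrizedProduct, shiftStep_path]
  by_cases hj : j = Fin.castLE hn
  · rw [if_pos hj, if_pos (hiff.1 hj)]; simp
  · rw [if_neg hj, if_neg (fun h => hj (hiff.2 h))]; simp

theorem not_orderSymmetricAGM (n : ℕ) (hn : 3 ≤ n) : ¬ OrderSymmetricAGM.{v} n 3 1 := by
  intro hagm
  -- `ULift` places the finite-dimensional space in the universe `v`. The inequality is tested in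
  -- the vector state of `ξ`.
  set ξ : EuclideanSpace ℂ (ULift.{v} (Fin (n + 1))) :=
    EuclideanSpace.single (ULift.up 0) (1 : ℂ)
  have hle := hagm (EuclideanSpace ℂ (ULift.{v} (Fin (n + 1)))) (shiftStep n)
  rw [Complex.ofReal_one, one_smul, ContinuousLinearMap.le_def] at hle
  have hpos := hle.inner_nonneg_right ξ
  let T : (EuclideanSpace ℂ (ULift.{v} (Fin (n + 1))) →L[ℂ]
      EuclideanSpace ℂ (ULift.{v} (Fin (n + 1)))) →ₗ[ℂ] ℂ :=
    { toFun := fun S => inner ℂ ξ (S ξ)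
      map_add' := fun S S' => by simp
      map_smul' := fun c S => by simp }
  have hT : 0 ≤ T (expWithReplacement (k := 3) symmetrizedProduct (shiftStep n) -
      expWithoutReplacement (k := 3) symmetrizedProduct (shiftStep n)) := hpos
  have hval : ∀ j : Fin 3 → Fin n, T (symmetrizedProduct fun i => shiftStep n (j i)) =
      if j = Fin.castLE hn then (1 : ℂ) else 0 := inner_symmetrizedProduct_shiftStep hn
  have hemb : ∀ j : Fin 3 ↪ Fin n, ((j : Fin 3 → Fin n) = Fin.castLE hn) ↔
      j = Fin.castLEEmb hn := fun j =>
    ⟨fun h => DFunLike.coe_injective h, fun h => h ▸ rfl⟩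
  rw [map_sub, map_expWithReplacement, map_expWithoutReplacement, expWithReplacement,
    expWithoutReplacement] at hT
  simp only [hval, hemb, Finset.sum_ite_eq', Finset.mem_univ, if_true, smul_eq_mul, mul_one] at hT
  have hre : (0 : ℝ) ≤ ((n : ℝ) ^ 3)⁻¹ - ((n - 3).factorial : ℝ) / (n.factorial : ℝ) := by
    rw [← Complex.zero_le_real]
    push_cast
    exact hT
  -- The test reads `1 / (n (n - 1) (n - 2)) ≤ 1 / n ^ 3`, which this strict inequality contradicts.
  have hlt : n.descFactorial 3 < n ^ 3 := Nat.descFactorial_lt_pow (by omega) (by norm_num)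
  have hf : (n.factorial : ℝ) = (n - 3).factorial * n.descFactorial 3 := by
    exact_mod_cast (Nat.factorial_mul_descFactorial hn).symm
  have hf0 : ((n - 3).factorial : ℝ) ≠ 0 := Nat.cast_ne_zero.2 (Nat.factorial_ne_zero _)
  have hd0 : (0 : ℝ) < n.descFactorial 3 := Nat.cast_pos.2 (Nat.descFactorial_pos.2 hn)
  rw [hf, div_mul_cancel_left₀ hf0, sub_nonneg] at hre
  have : ((n : ℝ) ^ 3)⁻¹ < (n.descFactorial 3 : ℝ)⁻¹ :=
    inv_strictAnti₀ hd0 (by exact_mod_cast hlt)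
  exact absurd hre (not_le.2 this)

end Shift

/-! ### Comparison of the two averages and conclusion -/

section Main

variable {A : Type*} [Ring A] [StarRing A] [Algebra ℂ A] [StarModule ℂ A] {φ : A →ₗ[ℂ] ℂ}
  {n : ℕ} {u : Fin n → A} {a b : A}

namespace FreeUnitaryData

/-- The average `𝔼_{wo,3}` of the products and the average `𝔼_{wr,3}` have the same trace. -/
theorem map_exp_eq (h : FreeUnitaryData φ u a b) (hn : 3 ≤ n) :
    φ (expWithoutReplacement
        (fun v : Fin 3 → A => v 0 * v 1 * v 2 * star (v 2) * star (v 1) * star (v 0))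
        (fun j => a * u j)) =
      φ (expWithReplacement
        (fun v : Fin 3 → A => v 0 * v 1 * v 2 * star (v 2) * star (v 1) * star (v 0))
        (fun j => a * u j)) := by
  have hn0 : (n : ℂ) ≠ 0 := Nat.cast_ne_zero.2 (by omega)
  rw [map_expWithoutReplacement, map_expWithReplacement]
  simp only [expWithoutReplacement, expWithReplacement, h.product_eq, h.map_product,
    Finset.sum_const, nsmul_eq_mul, Finset.card_univ, smul_eq_mul, mul_one]
  rw [factorial_ratio_mul_card hn]
  simp [hn0]

/-- If the two averages of the products agree then `φ (b * b) = 0`. -/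
theorem map_b_mul_b_eq_zero (h : FreeUnitaryData φ u a b) (hn : 3 ≤ n)
    (he : expWithoutReplacement
        (fun v : Fin 3 → A => v 0 * v 1 * v 2 * star (v 2) * star (v 1) * star (v 0))
        (fun j => a * u j) =
      expWithReplacement
        (fun v : Fin 3 → A => v 0 * v 1 * v 2 * star (v 2) * star (v 1) * star (v 0))
        (fun j => a * u j)) : φ (b * b) = 0 := by
  have : NeZero n := ⟨by omega⟩
  set T := φ ∘ₗ LinearMap.mulLeft ℂ (a * innerWord u a b 0 0 * a)
  set p : Fin n → ℂ := fun i => T (a * u i * (a * a) * star (u i) * a)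
  have hT : ∀ i j k : Fin n, T (a * u i * (a * u j) * (a * u k) * star (a * u k) *
      star (a * u j) * star (a * u i)) = p i + if 0 = i ∧ 0 = j then φ (b * b) else 0 := by
    intro i j k
    rw [h.product_eq]
    exact h.map_outer_mul_product 0 i j
  -- Distinct indices exclude the correction term, so without replacement only the mean of `p`
  -- remains.
  have hinj : ∀ j : Fin 3 ↪ Fin n, ¬ (0 = j 0 ∧ 0 = j 1) := fun j hj =>
    absurd (j.injective (hj.1.symm.trans hj.2)) (by decide)
  have h1 := expWithoutReplacement_apply this.ne hn 0 p
  have h2 := expWithReplacement_apply (k := 3) this.ne 0 p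
  have h3 := congrArg T he
  rw [map_expWithoutReplacement, map_expWithReplacement] at h3
  simp only [expWithoutReplacement, expWithReplacement, id_eq] at h1 h2 h3
  simp only [hT, hinj, if_false, add_zero, Finset.sum_add_distrib, smul_add] at h3
  rw [h1, h2, left_eq_add, smul_eq_mul, ← Finset.sum_filter, Finset.sum_const, nsmul_eq_mul] at h3
  -- With replacement the correction does occur, for instance at the constant tuple `0`, so its
  -- coefficient is nonzero.
  have hcard : (Finset.univ.filter fun j : Fin 3 → Fin n => 0 = j 0 ∧ 0 = j 1).card ≠ 0 :=
    Finset.card_ne_zero_of_mem (a := 0) (by simp)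
  simpa [this.ne, hcard] using h3

end FreeUnitaryData

end Main

theorem mainTheorem1 (n : ℕ) (hn : 3 ≤ n) :
    (∀ (H : Type u) [NormedAddCommGroup H] [InnerProductSpace ℂ H] [CompleteSpace H]
      (M : VonNeumannAlgebra H) (τ : M.toStarSubalgebra →ₗ[ℂ] ℂ), IsFaithfulNormalTracialState M τ →
      ∀ (u : Fin n → M.toStarSubalgebra) (a : M.toStarSubalgebra), (∀ j, u j ∈ unitary M.toStarSubalgebra) → IsSelfAdjoint a →
        FreelyIndependent τ (fun i : Option (Fin n) => i.elim a u) →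
        (∀ j, τ (u j) = 0) → τ a = 0 → τ (a ^ 2) = 1 → a ^ 2 ≠ 1 →
        ¬ expWithoutReplacement
              (fun v : Fin 3 → M.toStarSubalgebra => v 0 * v 1 * v 2 * star (v 2) * star (v 1) * star (v 0))
              (fun j => a * u j) ≤
            expWithReplacement
              (fun v : Fin 3 → M.toStarSubalgebra => v 0 * v 1 * v 2 * star (v 2) * star (v 1) * star (v 0))
              (fun j => a * u j)) ∧
    ¬ OrderSymmetricAGM.{v} n 3 1 := by
  refine ⟨?_, not_orderSymmetricAGM n hn⟩
  intro H _ _ _ M τ hτ u a hu ha hfree hu0 ha0 ha1 hne hle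
  have h : FreeUnitaryData τ u a (a ^ 2 - 1) :=
    { free := hfree
      tracial := hτ.tracial
      apply_one := hτ.map_one
      star_mul_self := fun i => (Unitary.mem_iff.1 (hu i)).1
      mul_star_self := fun i => (Unitary.mem_iff.1 (hu i)).2
      map_unitary := hu0
      map_star_unitary := fun i => hτ.apply_star_eq_zero (hu0 i)
      map_a := ha0
      map_b := by rw [map_sub, ha1, hτ.map_one, sub_self]
      star_a := ha
      a_mul_a := by rw [pow_two]; abel }
  have hb := h.map_b_mul_b_eq_zero hn (hτ.eq_of_le_of_apply_eq hle (h.map_exp_eq hn))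
  have hs : star (a ^ 2 - 1) = a ^ 2 - 1 := by rw [star_sub, star_pow, ha.star_eq, star_one]
  exact hne (sub_eq_zero.1 (hτ.faithful _ (by rw [hs, hb])))
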